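/- An elliptic function is a meromorphic function on $\mathbb{C}$ having two periods whose ratio is not real. An elliptic function $q$ is called a Picard–KdV potential (or simply a Picard potential) if for every $z\in\mathbb{C}$ the differential equation $y''(x)+q(x)y(x)=z\,y(x)$ has a fundamental system of solutions (two linearly independent solutions) that are meromorphic on $\mathbb{C}$. **Theorem 3.5.** Let $q$ be a Picard potential, let $\Lambda=\mathbb{Z}\,2\omega_1+\mathbb{Z}\,2\omega_3$ be the lattice generated by periods $2\omega_1,2\omega_3$ of $q$ with non-real ratio (for instance fundamental periods of $q$), and let $$\wp(x)=\frac1{x^2}+\sum_{\lambda\in\Lambda\setminus\{0\}}\left(\frac1{(x-\lambda)^2}-\frac1{\lambda^2}\right)$$ be the Weierstrass function of $\Lambda$. Then there are an integer $m\ge 0$, integers $s_1,\dots,s_m$ and complex numbers $C,b_1,\dots,b_m$ with $b_j-b_k\notin\Lambda$ for $j\neq k$ such that $$q(x)=C-\sum_{j=1}^m s_j(s_j+1)\,\wp(x-b_j)$$ as meromorphic functions of $x\in\mathbb{C}$. -/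

import Mathlib

open Filter

namespace PicardKdV

/- Conventions. A meromorphic function on the complex plane is represented by a function
`f : ℂ → ℂ` with `Meromorphic f`. Its values at poles carry no information, so two
representatives stand for the same meromorphic function exactly when they agree off a closed
discrete set, that is, along the filter `codiscrete ℂ`. -/

/-- The two periods in `L` (which are linearly independent over `ℝ`, i.e. have a non-real ratio)
are periods of the meromorphic function `f`. They need not be fundamental periods. -/
def HasPeriods (L : PeriodPair) (f : ℂ → ℂ) : Prop :=
  (∀ᶠ x in codiscrete ℂ, f (x + L.ω₁) = f x) ∧ (∀ᶠ x in codiscrete ℂ, f (x + L.ω₂) = f x)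

/-- An elliptic function: a doubly periodic meromorphic function. -/
def IsElliptic (f : ℂ → ℂ) : Prop :=
  Meromorphic f ∧ ∃ L : PeriodPair, HasPeriods L f

/-- `y` is a meromorphic solution on `ℂ` of `y'' + q y = z y`. -/
def IsMeromorphicSolution (q : ℂ → ℂ) (z : ℂ) (y : ℂ → ℂ) : Prop :=
  Meromorphic y ∧ ∀ᶠ x in codiscrete ℂ, deriv (deriv y) x + q x * y x = z * y x

/-- The second-order equation `y'' + q y = z y` has a fundamental system of solutions consisting
of meromorphic functions: two meromorphic solutions that are linearly independent over `ℂ`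
(as meromorphic functions). -/
def HasMeromorphicFundamentalSystem (q : ℂ → ℂ) (z : ℂ) : Prop :=
  ∃ y₁ y₂ : ℂ → ℂ, IsMeromorphicSolution q z y₁ ∧ IsMeromorphicSolution q z y₂ ∧
    ∀ c₁ c₂ : ℂ, (∀ᶠ x in codiscrete ℂ, c₁ * y₁ x + c₂ * y₂ x = 0) → c₁ = 0 ∧ c₂ = 0

/-- A Picard-KdV potential: an elliptic function `q` such that `y'' + q y = z y` has a
meromorphic fundamental system of solutions for every value of the spectral parameter `z`. -/
def IsPicardPotential (q : ℂ → ℂ) : Prop :=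
  IsElliptic q ∧ ∀ z : ℂ, HasMeromorphicFundamentalSystem q z

end PicardKdV

namespace PicardKdV

open Topology

/-! Near a point `p` the equation forces `q` to have at most a double pole, and the indicial
equation makes its leading coefficient `-s(s+1)`, where `-s ≤ 0` is the order at `p` of some
solution (`exists_isLocalSolution_order_nonpos`). The residue `c` remains to be killed. The
Frobenius recursion at exponent `-s` degenerates at index `2s+1`, where its right-hand side must
vanish for every `z`. That right-hand side grows like `c * r * (-z)^s` with `r > 0` as `z = -w` runs
to infinity through the negative integers, so `c = 0` (`eq_zero_of_frobenius_recursion`). Hence `q`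
has the principal part of `-s(s+1)℘(x-p)` at every `p`. Adding these terms over the poles in a
fundamental domain leaves a doubly periodic function with removable singularities, which is constant
by Liouville (`exists_eventually_eq_const`). -/

/-! ### Growth of the Frobenius recursion in the spectral parameter -/

lemma tendsto_div_pow_of_lt {u : ℕ → ℂ} {k n : ℕ} {l : ℂ} (hkn : k < n)
    (hu : Tendsto (fun w : ℕ ↦ u w / (w : ℂ) ^ k) atTop (𝓝 l)) :
    Tendsto (fun w : ℕ ↦ u w / (w : ℂ) ^ n) atTop (𝓝 0) := by
  have h1 : Tendsto (fun w : ℕ ↦ ((w : ℂ)⁻¹) ^ (n - k)) atTop (𝓝 0) := by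
    simpa [Nat.sub_ne_zero_of_lt hkn] using
      (tendsto_inv_atTop_nhds_zero_nat (𝕜 := ℂ)).pow (n - k)
  have h2 := hu.mul h1
  rw [mul_zero] at h2
  refine h2.congr' ?_
  filter_upwards with w
  rw [← Nat.add_sub_of_le hkn.le, pow_add, Nat.add_sub_cancel_left, inv_pow, div_mul_eq_div_div,
    div_eq_mul_inv (u w / _)]

/-- The leading term in the spectral parameter of the right-hand side of the Frobenius
recursion. -/
lemma exists_tendsto_recursion_rhs (c : ℂ) (h : ℕ → ℂ) (b : ℕ → ℕ → ℂ) (m : ℕ)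
    (hb : ∀ k ≤ m + 1, ∃ r : ℝ, 0 < r ∧
      Tendsto (fun w : ℕ ↦ b w k / (w : ℂ) ^ (k / 2)) atTop
        (𝓝 ((if Even k then 1 else c) * r))) :
    ∃ r : ℝ, 0 < r ∧ Tendsto (fun w : ℕ ↦ (c * b w (m + 1) + (m + 1) * (w * b w m +
      ∑ j ∈ Finset.range (m + 1), b w j * h j)) / (w : ℂ) ^ (m / 2 + 1)) atTop
        (𝓝 ((if Even m then 1 else c) * r)) := by
  have hsum : Tendsto (fun w : ℕ ↦ (m + 1 : ℂ) * ∑ j ∈ Finset.range (m + 1),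
      b w j / (w : ℂ) ^ (m / 2 + 1) * h j) atTop
      (𝓝 ((m + 1) * ∑ j ∈ Finset.range (m + 1), 0 * h j)) := by
    refine Tendsto.const_mul _ (tendsto_finsetSum _ fun j hj ↦ ?_)
    have hj' : j ≤ m := Nat.lt_succ_iff.mp (Finset.mem_range.mp hj)
    obtain ⟨r, -, hr⟩ := hb j (by omega)
    exact (tendsto_div_pow_of_lt (by omega) hr).mul_const _
  simp only [zero_mul, Finset.sum_const_zero, mul_zero] at hsum
  obtain ⟨r₀, hr₀, ht₀⟩ := hb m (by omega)
  obtain ⟨r₁, hr₁, ht₁⟩ := hb (m + 1) le_rfl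
  have key : ∀ l, Tendsto (fun w : ℕ ↦ b w (m + 1) / (w : ℂ) ^ (m / 2 + 1)) atTop (𝓝 l) →
      Tendsto (fun w : ℕ ↦ (c * b w (m + 1) + (m + 1) * (w * b w m +
      ∑ j ∈ Finset.range (m + 1), b w j * h j)) / (w : ℂ) ^ (m / 2 + 1)) atTop
        (𝓝 (c * l + (m + 1) * ((if Even m then 1 else c) * r₀))) := by
    intro l hl
    have := ((hl.const_mul c).add (ht₀.const_mul (m + 1 : ℂ))).add hsum
    rw [add_zero] at this
    refine this.congr' ?_
    filter_upwards [eventually_gt_atTop 0] with w hw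
    have hw' : (w : ℂ) ≠ 0 := by exact_mod_cast hw.ne'
    simp_rw [div_mul_eq_mul_div, ← Finset.sum_div]
    field_simp
    ring
  -- For even `m`, `b w (m + 1)` is of lower order and only `w * b w m` counts. For odd `m`, both
  -- terms contribute positive multiples of `c`, so they cannot cancel.
  rcases Nat.even_or_odd m with hm | hm
  · refine ⟨(m + 1) * r₀, by positivity, ?_⟩
    have := key 0 (tendsto_div_pow_of_lt (by obtain ⟨n, rfl⟩ := hm; omega) ht₁)
    simpa [hm] using this
  · refine ⟨r₁ + (m + 1) * r₀, by positivity, ?_⟩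
    have hm1 : Even (m + 1) := by simpa [Nat.even_add_one] using hm
    have hm2 : ¬ Even m := by simpa using hm
    have he : (m + 1) / 2 = m / 2 + 1 := by obtain ⟨n, rfl⟩ := hm; omega
    rw [he] at ht₁
    convert! key _ ht₁ using 2
    simp only [hm1, hm2, if_true, if_false]
    push_cast
    ring

/-- If the Frobenius recursion at the smaller exponent `-s` is solvable for every value of the
spectral parameter `z = -w`, then the coefficient `c` of the simple pole vanishes. -/
lemma eq_zero_of_frobenius_recursion (s : ℕ) (c : ℂ) (h : ℕ → ℕ → ℂ) (b : ℕ → ℕ → ℂ)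
    (hb0 : ∀ w, b w 0 = 1) (hb1 : ∀ w, 2 * s * b w 1 = c * b w 0)
    (hrec : ∀ w m : ℕ, (2 * s - (m + 1)) * b w (m + 2) = c * b w (m + 1) + (m + 1) * (w * b w m +
      ∑ j ∈ Finset.range (m + 1), b w j * h m j)) : c = 0 := by
  rcases Nat.eq_zero_or_pos s with rfl | hs
  · simpa [hb0] using (hb1 0).symm
  have hasym : ∀ k ≤ 2 * s, ∃ r : ℝ, 0 < r ∧
      Tendsto (fun w : ℕ ↦ b w k / (w : ℂ) ^ (k / 2)) atTop
        (𝓝 ((if Even k then 1 else c) * r)) := by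
    intro k
    induction k using Nat.strong_induction_on with
    | _ k ih =>
    intro hk
    match k, ih, hk with
    | 0, _, _ => exact ⟨1, one_pos, by simp [hb0]⟩
    | 1, _, _ =>
      refine ⟨1 / (2 * s), by positivity, ?_⟩
      have : ∀ w, b w 1 = c * (1 / (2 * s)) := fun w ↦ by
        have := hb1 w
        rw [hb0] at this
        have hs' : (s : ℂ) ≠ 0 := by exact_mod_cast hs.ne'
        field_simp
        linear_combination this
      simp [this]
    | m + 2, ih, hk =>
      obtain ⟨r, hr, ht⟩ := exists_tendsto_recursion_rhs c (h m) b m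
        fun k hk' ↦ ih k (by omega) (by omega)
      -- Below the resonance the divisor is positive, which preserves the sign of `r`.
      have hpos : (0 : ℝ) < 2 * s - (m + 1) := by
        have : (m : ℝ) + 2 ≤ 2 * s := by exact_mod_cast hk
        linarith
      refine ⟨r / (2 * s - (m + 1)), by positivity, ?_⟩
      have hne : (2 * s - (m + 1) : ℂ) ≠ 0 := by exact_mod_cast hpos.ne'
      have := ht.div_const (2 * s - (m + 1) : ℂ)
      have hev : Even (m + 2) ↔ Even m := by simp [Nat.even_add]
      simp only [hev]
      rw [show (m + 2) / 2 = m / 2 + 1 by omega]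
      push_cast
      rw [← mul_div_assoc]
      refine this.congr fun w ↦ ?_
      rw [← hrec]
      field_simp
  -- Resonance: the left-hand side of the recursion vanishes at this odd `m`, so the limit `c * r`
  -- is zero.
  obtain ⟨m, hm⟩ : ∃ m, 2 * s = m + 1 := ⟨2 * s - 1, by omega⟩
  obtain ⟨r, hr, ht⟩ := exists_tendsto_recursion_rhs c (h m) b m fun k hk ↦ hasym k (by omega)
  have hodd : ¬ Even m := by
    intro he
    obtain ⟨n, rfl⟩ := he
    omega
  have h0 : (2 * s - (m + 1) : ℂ) = 0 := by
    rw [sub_eq_zero]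
    exact_mod_cast hm
  simp only [← hrec, h0, zero_mul, zero_div, hodd, if_false] at ht
  have := tendsto_nhds_unique ht tendsto_const_nhds
  simpa [hr.ne'] using this

/-! ### Local analysis of the equation at a point -/

lemma exists_analyticAt_eq_add_mul {f : ℂ → ℂ} {p : ℂ} (hf : AnalyticAt ℂ f p) :
    ∃ g : ℂ → ℂ, AnalyticAt ℂ g p ∧ ∀ x, f x = f p + (x - p) * g x := by
  obtain ⟨P, hP⟩ := hf
  refine ⟨dslope f p, ⟨_, hP.has_fpower_series_dslope_fslope⟩, fun x ↦ ?_⟩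
  have := sub_smul_dslope f p x
  rw [smul_eq_mul] at this
  rw [this]
  ring

lemma iteratedDeriv_sub_mul {f : ℂ → ℂ} {p : ℂ} (hf : AnalyticAt ℂ f p) (m : ℕ) :
    iteratedDeriv (m + 1) (fun x ↦ (x - p) * f x) p = (m + 1) * iteratedDeriv m f p := by
  induction m generalizing f with
  | zero =>
    have h := ((hasDerivAt_id p).sub_const p).fun_mul hf.differentiableAt.hasDerivAt
    simpa [iteratedDeriv_one] using h.deriv
  | succ m ih =>
    rw [iteratedDeriv_succ']
    have hd : deriv (fun x ↦ (x - p) * f x) =ᶠ[𝓝 p] fun x ↦ f x + (x - p) * deriv f x := by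
      filter_upwards [hf.eventually_analyticAt] with x hx
      have h := ((hasDerivAt_id x).sub_const p).fun_mul hx.differentiableAt.hasDerivAt
      simpa using h.deriv
    rw [hd.iteratedDeriv_eq, iteratedDeriv_fun_add hf.contDiffAt
      (by have := hf.deriv; exact AnalyticAt.contDiffAt (by fun_prop)), ih hf.deriv,
      ← iteratedDeriv_succ']
    push_cast
    ring

lemma deriv_deriv_zpow_mul {y g : ℂ → ℂ} {p : ℂ} {n : ℤ} (hg : AnalyticAt ℂ g p)
    (hy : ∀ᶠ x in 𝓝[≠] p, y x = (x - p) ^ n * g x) :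
    ∀ᶠ x in 𝓝[≠] p, (x - p) ^ 2 * deriv (deriv y) x =
      (x - p) ^ n * (n * (n - 1) * g x + 2 * n * (x - p) * deriv g x +
        (x - p) ^ 2 * deriv (deriv g) x) := by
  have aux : ∀ (k : ℤ) (f : ℂ → ℂ) (x : ℂ), x ≠ p → AnalyticAt ℂ f x →
      HasDerivAt (fun x ↦ (x - p) ^ k * f x)
        (k * (x - p) ^ (k - 1) * f x + (x - p) ^ k * deriv f x) x := by
    intro k f x hx hf
    have h := ((hasDerivAt_zpow k (x - p) (.inl (sub_ne_zero.mpr hx))).comp x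
      ((hasDerivAt_id x).sub_const p)).fun_mul hf.differentiableAt.hasDerivAt
    simpa using h
  have hyd : deriv (deriv y) =ᶠ[𝓝[≠] p] deriv (deriv fun x ↦ (x - p) ^ n * g x) :=
    (EventuallyEq.nhdsNE_deriv hy).nhdsNE_deriv
  have hd : deriv (fun x ↦ (x - p) ^ n * g x) =ᶠ[𝓝[≠] p]
      fun x ↦ (x - p) ^ (n - 1) * (n * g x + (x - p) * deriv g x) := by
    filter_upwards [hg.eventually_analyticAt.filter_mono nhdsWithin_le_nhds,
      self_mem_nhdsWithin] with x hx hxp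
    rw [(aux n g x hxp hx).deriv]
    have : x - p ≠ 0 := sub_ne_zero.mpr hxp
    rw [zpow_sub_one₀ this]
    field_simp
  filter_upwards [hyd, hd.nhdsNE_deriv, hg.eventually_analyticAt.filter_mono nhdsWithin_le_nhds,
      self_mem_nhdsWithin] with x h1 h2 hx hxp
  have hx' := hx.deriv
  have hxn : x - p ≠ 0 := sub_ne_zero.mpr hxp
  have h3 : HasDerivAt (fun x ↦ n * g x + (x - p) * deriv g x)
      (n * deriv g x + (deriv g x + (x - p) * deriv (deriv g) x)) x := by
    have h := (hx.differentiableAt.hasDerivAt.const_mul (n : ℂ)).fun_add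
      (((hasDerivAt_id x).sub_const p).fun_mul hx'.differentiableAt.hasDerivAt)
    simpa using h
  rw [h1, h2, (aux (n - 1) _ x hxp (by fun_prop)).deriv, h3.deriv, zpow_sub_one₀ hxn,
    zpow_sub_one₀ hxn]
  push_cast
  field_simp
  ring

/-- `y` is a meromorphic solution of `y'' + q y = z y` on a punctured neighbourhood of `p`. -/
def IsLocalSolution (q : ℂ → ℂ) (z p : ℂ) (y : ℂ → ℂ) : Prop :=
  MeromorphicAt y p ∧ ∀ᶠ x in 𝓝[≠] p, deriv (deriv y) x + q x * y x = z * y x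

lemma IsLocalSolution.eventually_frobenius {q y g : ℂ → ℂ} {z p : ℂ} {n : ℤ}
    (hs : IsLocalSolution q z p y) (hg : AnalyticAt ℂ g p)
    (hy : ∀ᶠ x in 𝓝[≠] p, y x = (x - p) ^ n * g x) :
    ∀ᶠ x in 𝓝[≠] p, n * (n - 1) * g x + 2 * n * (x - p) * deriv g x +
      (x - p) ^ 2 * deriv (deriv g) x + (x - p) ^ 2 * q x * g x - z * (x - p) ^ 2 * g x = 0 := by
  filter_upwards [deriv_deriv_zpow_mul hg hy, hs.2, hy, self_mem_nhdsWithin] with x h1 h2 h3 hxp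
  have hxn : (x - p) ^ n ≠ 0 := zpow_ne_zero _ (sub_ne_zero.mpr hxp)
  refine mul_left_cancel₀ hxn ?_
  rw [h3] at h2
  linear_combination (x - p) ^ 2 * h2 - h1

/-- A potential with a nonzero local solution has at most a double pole. -/
lemma IsLocalSolution.exists_analyticAt_eq_sq_mul {q y : ℂ → ℂ} {z p : ℂ}
    (hs : IsLocalSolution q z p y) (hy : meromorphicOrderAt y p ≠ ⊤) :
    ∃ Q : ℂ → ℂ, AnalyticAt ℂ Q p ∧ ∀ᶠ x in 𝓝[≠] p, (x - p) ^ 2 * q x = Q x := by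
  obtain ⟨n, hn⟩ := WithTop.ne_top_iff_exists.mp hy
  obtain ⟨g, hg, hg0, hyg⟩ := (meromorphicOrderAt_eq_int_iff hs.1).mp hn.symm
  have hg1 := hg.deriv
  have hg2 := hg1.deriv
  -- The equation solved for `(x - p) ^ 2 * q x`; dividing by `g` is harmless since `g p ≠ 0`.
  refine ⟨fun x ↦ z * (x - p) ^ 2 - (n * (n - 1) * g x + 2 * n * (x - p) * deriv g x +
      (x - p) ^ 2 * deriv (deriv g) x) / g x, by fun_prop (disch := assumption), ?_⟩
  filter_upwards [hs.eventually_frobenius hg hyg,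
    (hg.continuousAt.eventually_ne hg0).filter_mono nhdsWithin_le_nhds] with x h1 h2
  field_simp
  linear_combination h1

/-- With `(x - p) ^ 2 * q` replaced by the analytic `Q`, the identity extends across `p`, where it
can be evaluated and differentiated. -/
lemma IsLocalSolution.frobenius {q Q y g : ℂ → ℂ} {z p : ℂ} {n : ℤ}
    (hs : IsLocalSolution q z p y) (hQ : AnalyticAt ℂ Q p)
    (hqQ : ∀ᶠ x in 𝓝[≠] p, (x - p) ^ 2 * q x = Q x) (hg : AnalyticAt ℂ g p)
    (hy : ∀ᶠ x in 𝓝[≠] p, y x = (x - p) ^ n * g x) :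
    ∀ᶠ x in 𝓝 p, n * (n - 1) * g x + 2 * n * (x - p) * deriv g x +
      (x - p) ^ 2 * deriv (deriv g) x + Q x * g x - z * (x - p) ^ 2 * g x = 0 := by
  have hg1 := hg.deriv
  have hg2 := hg1.deriv
  refine (AnalyticAt.frequently_eq_iff_eventually_eq (by fun_prop) analyticAt_const).mp
    (Eventually.frequently ?_)
  filter_upwards [hs.eventually_frobenius hg hy, hqQ] with x h1 h2
  rwa [h2] at h1

lemma IsLocalSolution.indicial {q Q y : ℂ → ℂ} {z p : ℂ} {n : ℤ}
    (hs : IsLocalSolution q z p y) (hQ : AnalyticAt ℂ Q p)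
    (hqQ : ∀ᶠ x in 𝓝[≠] p, (x - p) ^ 2 * q x = Q x) (hy : meromorphicOrderAt y p = n) :
    (n * (n - 1) : ℂ) = - Q p := by
  obtain ⟨g, hg, hg0, hyg⟩ := (meromorphicOrderAt_eq_int_iff hs.1).mp hy
  have := (hs.frobenius hQ hqQ hg hyg).self_of_nhds
  simp only [sub_self, mul_zero, zero_mul, zero_pow two_ne_zero, add_zero, sub_zero] at this
  refine mul_right_cancel₀ hg0 ?_
  linear_combination this

lemma IsLocalSolution.linear_combination {q y₁ y₂ : ℂ → ℂ} {z p : ℂ}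
    (h₁ : IsLocalSolution q z p y₁) (h₂ : IsLocalSolution q z p y₂) (c₁ c₂ : ℂ) :
    IsLocalSolution q z p (fun x ↦ c₁ * y₁ x + c₂ * y₂ x) := by
  have m₁ := h₁.1
  have m₂ := h₂.1
  refine ⟨by fun_prop, ?_⟩
  have hd : deriv (fun x ↦ c₁ * y₁ x + c₂ * y₂ x) =ᶠ[𝓝[≠] p]
      fun x ↦ c₁ * deriv y₁ x + c₂ * deriv y₂ x := by
    filter_upwards [m₁.eventually_analyticAt, m₂.eventually_analyticAt] with x a₁ a₂
    exact ((a₁.differentiableAt.hasDerivAt.const_mul c₁).fun_add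
      (a₂.differentiableAt.hasDerivAt.const_mul c₂)).deriv
  filter_upwards [hd.nhdsNE_deriv, m₁.eventually_analyticAt, m₂.eventually_analyticAt,
    h₁.2, h₂.2] with x hx a₁ a₂ e₁ e₂
  have a₁' := a₁.deriv
  have a₂' := a₂.deriv
  rw [hx, ((a₁'.differentiableAt.hasDerivAt.const_mul c₁).fun_add
      (a₂'.differentiableAt.hasDerivAt.const_mul c₂)).deriv]
  linear_combination c₁ * e₁ + c₂ * e₂

/-- Among the solutions spanned by two independent ones, some solution has order at most `0`. -/
lemma exists_isLocalSolution_order_nonpos {q Q y₁ y₂ : ℂ → ℂ} {z p : ℂ}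
    (hQ : AnalyticAt ℂ Q p) (hqQ : ∀ᶠ x in 𝓝[≠] p, (x - p) ^ 2 * q x = Q x)
    (h₁ : IsLocalSolution q z p y₁) (h₂ : IsLocalSolution q z p y₂)
    (hind : ∀ c₁ c₂ : ℂ, (∀ᶠ x in 𝓝[≠] p, c₁ * y₁ x + c₂ * y₂ x = 0) → c₁ = 0 ∧ c₂ = 0) :
    ∃ (y : ℂ → ℂ) (s : ℕ), IsLocalSolution q z p y ∧
      meromorphicOrderAt y p = ((-s : ℤ) : WithTop ℤ) := by
  have ho₁ : meromorphicOrderAt y₁ p ≠ ⊤ := fun h ↦ by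
    simpa using hind 1 0 (by simpa using meromorphicOrderAt_eq_top_iff.mp h)
  have ho₂ : meromorphicOrderAt y₂ p ≠ ⊤ := fun h ↦ by
    simpa using hind 0 1 (by simpa using meromorphicOrderAt_eq_top_iff.mp h)
  obtain ⟨n₁, hn₁⟩ := WithTop.ne_top_iff_exists.mp ho₁
  obtain ⟨n₂, hn₂⟩ := WithTop.ne_top_iff_exists.mp ho₂
  have close : ∀ (y : ℂ → ℂ) (n : ℤ), IsLocalSolution q z p y → (n : WithTop ℤ) =
      meromorphicOrderAt y p → n ≤ 0 → ∃ (y : ℂ → ℂ) (s : ℕ), IsLocalSolution q z p y ∧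
        meromorphicOrderAt y p = ((-s : ℤ) : WithTop ℤ) := by
    intro y n hy hn hle
    refine ⟨y, n.natAbs, hy, ?_⟩
    rw [← hn, Int.ofNat_natAbs_of_nonpos hle, neg_neg]
  rcases le_or_gt n₁ 0 with hle₁ | hpos₁
  · exact close y₁ n₁ h₁ hn₁ hle₁
  rcases le_or_gt n₂ 0 with hle₂ | hpos₂
  · exact close y₂ n₂ h₂ hn₂ hle₂
  exfalso
  -- Distinct indicial roots sum to `1`, so at most one integer root is positive.
  have hroot : ∀ a b : ℤ, 0 < a → 0 < b → (a * (a - 1) : ℂ) = - Q p →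
      (b * (b - 1) : ℂ) = - Q p → a = b := by
    intro a b ha hb ea eb
    have h : a * (a - 1) = b * (b - 1) := by exact_mod_cast ea.trans eb.symm
    have h' : (a - b) * (a + b - 1) = 0 := by linear_combination h
    rcases mul_eq_zero.mp h' with h' | h' <;> omega
  have heq := hroot _ _ hpos₁ hpos₂ (h₁.indicial hQ hqQ hn₁.symm) (h₂.indicial hQ hqQ hn₂.symm)
  subst heq
  obtain ⟨g₁, hg₁, hg₁0, hyg₁⟩ := (meromorphicOrderAt_eq_int_iff h₁.1).mp hn₁.symm
  obtain ⟨g₂, hg₂, hg₂0, hyg₂⟩ := (meromorphicOrderAt_eq_int_iff h₂.1).mp hn₂.symm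
  -- Cancelling the leading coefficients gives a nonzero solution of strictly larger order, hence a
  -- second positive root.
  have h₃ := h₁.linear_combination h₂ (g₂ p) (-g₁ p)
  have ho₃ : meromorphicOrderAt (fun x ↦ g₂ p * y₁ x + -g₁ p * y₂ x) p ≠ ⊤ := fun h ↦
    hg₂0 (hind _ _ (meromorphicOrderAt_eq_top_iff.mp h)).1
  obtain ⟨n₃, hn₃⟩ := WithTop.ne_top_iff_exists.mp ho₃
  obtain ⟨g, hg, hgeq⟩ := exists_analyticAt_eq_add_mul
    (f := fun x ↦ g₂ p * g₁ x + -g₁ p * g₂ x) (p := p) (by fun_prop)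
  have hfac : ∀ᶠ x in 𝓝[≠] p, g₂ p * y₁ x + -g₁ p * y₂ x = ((· - p) ^ (n₁ + 1) * g) x := by
    filter_upwards [hyg₁, hyg₂, self_mem_nhdsWithin] with x e₁ e₂ hxp
    have hx := hgeq x
    simp only [Pi.mul_apply, Pi.pow_apply]
    rw [e₁, e₂, smul_eq_mul, smul_eq_mul, zpow_add_one₀ (sub_ne_zero.mpr hxp)]
    linear_combination (x - p) ^ n₁ * hx
  have hlt : n₁ < n₃ := by
    have h4 := meromorphicOrderAt_congr hfac
    rw [meromorphicOrderAt_mul (by fun_prop) hg.meromorphicAt] at h4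
    have h5 : meromorphicOrderAt ((fun x ↦ x - p) ^ (n₁ + 1)) p = ((n₁ + 1 : ℤ) : WithTop ℤ) :=
      meromorphicOrderAt_zpow_id_sub_const
    have h6 : ((n₁ + 1 : ℤ) : WithTop ℤ) ≤ n₃ := by
      rw [hn₃, h4, h5]
      exact le_add_of_nonneg_right hg.meromorphicOrderAt_nonneg
    have := WithTop.coe_le_coe.mp h6
    omega
  have := hroot _ _ hpos₁ (hpos₁.trans hlt) (h₁.indicial hQ hqQ hn₁.symm)
    (h₃.indicial hQ hqQ hn₃.symm)
  omega

/-- At every point, a potential all of whose spectral problems are locally solvable in meromorphic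
functions has principal part `-s (s + 1) / (x - p) ^ 2`. -/
lemma exists_eventuallyEq_principal_part {q : ℂ → ℂ} {p : ℂ}
    (hfs : ∀ z : ℂ, ∃ y₁ y₂ : ℂ → ℂ, IsLocalSolution q z p y₁ ∧ IsLocalSolution q z p y₂ ∧
      ∀ c₁ c₂ : ℂ, (∀ᶠ x in 𝓝[≠] p, c₁ * y₁ x + c₂ * y₂ x = 0) → c₁ = 0 ∧ c₂ = 0) :
    ∃ (s : ℤ) (g : ℂ → ℂ), AnalyticAt ℂ g p ∧
      ∀ᶠ x in 𝓝[≠] p, q x = -(s * (s + 1)) / (x - p) ^ 2 + g x := by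
  obtain ⟨Q, hQ, hqQ⟩ : ∃ Q : ℂ → ℂ, AnalyticAt ℂ Q p ∧
      ∀ᶠ x in 𝓝[≠] p, (x - p) ^ 2 * q x = Q x := by
    obtain ⟨y₁, y₂, h₁, -, hind⟩ := hfs 0
    refine h₁.exists_analyticAt_eq_sq_mul fun h ↦ ?_
    simpa using hind 1 0 (by simpa using meromorphicOrderAt_eq_top_iff.mp h)
  have hsol : ∀ z : ℂ, ∃ (y : ℂ → ℂ) (s : ℕ), IsLocalSolution q z p y ∧
      meromorphicOrderAt y p = ((-s : ℤ) : WithTop ℤ) := fun z ↦ by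
    obtain ⟨y₁, y₂, h₁, h₂, hind⟩ := hfs z
    exact exists_isLocalSolution_order_nonpos hQ hqQ h₁ h₂ hind
  choose y s' hy hord using hsol
  have hind : ∀ z, (s' z * (s' z + 1) : ℂ) = - Q p := fun z ↦ by
    rw [← (hy z).indicial hQ hqQ (hord z)]
    push_cast
    ring
  -- The exponent does not depend on `z`, because `n ↦ n(n+1)` is injective on the naturals.
  obtain ⟨s, hs⟩ : ∃ s : ℕ, ∀ z, s' z = s := by
    refine ⟨s' 0, fun z ↦ ?_⟩
    have h : s' z * (s' z + 1) = s' 0 * (s' 0 + 1) := by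
      exact_mod_cast (hind z).trans (hind 0).symm
    nlinarith
  simp only [hs] at hord hind
  have hsQ := hind 0
  have hfac : ∀ z, ∃ g : ℂ → ℂ, AnalyticAt ℂ g p ∧ g p ≠ 0 ∧
      ∀ᶠ x in 𝓝[≠] p, y z x = (x - p) ^ (-s : ℤ) * g x := fun z ↦
    (meromorphicOrderAt_eq_int_iff (hy z).1).mp (hord z)
  choose Y hY hY0 hyY using hfac
  obtain ⟨Q₁, hQ₁, hQQ₁⟩ := exists_analyticAt_eq_add_mul hQ
  obtain ⟨h, hh, hQh⟩ := exists_analyticAt_eq_add_mul hQ₁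
  -- Substituting `Q = -s(s+1) + Q₁ p * (x - p) + h * (x - p) ^ 2` cancels the constant term, so one
  -- factor `x - p` divides out.
  have hode : ∀ z, (fun x ↦ (x - p) * (deriv (deriv (Y z)) x + Y z x * h x - z * Y z x) +
      (Q₁ p * Y z x - 2 * s * deriv (Y z) x)) =ᶠ[𝓝 p] fun _ ↦ 0 := by
    intro z
    have a := hY z
    have a1 := a.deriv
    have a2 := a1.deriv
    refine (AnalyticAt.frequently_eq_iff_eventually_eq (by fun_prop) analyticAt_const).mp
      (Eventually.frequently ?_)
    filter_upwards [((hy z).frobenius hQ hqQ (hY z) (hyY z)).filter_mono nhdsWithin_le_nhds,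
      self_mem_nhdsWithin] with x e hxp
    refine mul_left_cancel₀ (sub_ne_zero.mpr hxp) ?_
    rw [hQQ₁, hQh] at e
    push_cast at e
    linear_combination e - Y z x * hsQ
  have hc : Q₁ p = 0 := by
    -- The unknowns are normalised derivatives at `p` rather than Taylor coefficients; the recursion
    -- is the derivative of order `m + 1` of `hode`, with binomial weights from Leibniz.
    refine eq_zero_of_frobenius_recursion s (Q₁ p)
      (fun m j ↦ m.choose j * iteratedDeriv (m - j) h p)
      (fun w k ↦ iteratedDeriv k (Y (-w)) p / Y (-w) p) ?_ ?_ ?_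
    · intro w
      simp [hY0]
    · intro w
      have := (hode (-w)).self_of_nhds
      simp only [sub_self, zero_mul, zero_add] at this
      simp only [iteratedDeriv_one, iteratedDeriv_zero]
      linear_combination (-1 / Y (-w) p) * this
    · intro w m
      have a := hY (-w)
      have a1 := a.deriv
      have a2 := a1.deriv
      have e := (hode (-w)).iteratedDeriv_eq (m + 1)
      rw [iteratedDeriv_fun_add (AnalyticAt.contDiffAt (by fun_prop))
        (AnalyticAt.contDiffAt (by fun_prop)), iteratedDeriv_sub_mul (by fun_prop),
        iteratedDeriv_fun_sub (AnalyticAt.contDiffAt (by fun_prop))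
        (AnalyticAt.contDiffAt (by fun_prop)),
        iteratedDeriv_fun_sub (AnalyticAt.contDiffAt (by fun_prop))
        (AnalyticAt.contDiffAt (by fun_prop)),
        iteratedDeriv_fun_add (AnalyticAt.contDiffAt (by fun_prop))
        (AnalyticAt.contDiffAt (by fun_prop)),
        iteratedDeriv_fun_mul (AnalyticAt.contDiffAt (by fun_prop))
        (AnalyticAt.contDiffAt (by fun_prop)), iteratedDeriv_const_mul_field,
        iteratedDeriv_const_mul_field, iteratedDeriv_const_mul_field, ← iteratedDeriv_succ',
        ← iteratedDeriv_succ'] at e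
      have hsum : ∑ j ∈ Finset.range (m + 1), iteratedDeriv j (Y (-w)) p / Y (-w) p *
          (m.choose j * iteratedDeriv (m - j) h p) = (∑ j ∈ Finset.range (m + 1),
          m.choose j * iteratedDeriv j (Y (-w)) p * iteratedDeriv (m - j) h p) / Y (-w) p := by
        rw [Finset.sum_div]
        exact Finset.sum_congr rfl fun j _ ↦ by ring
      rw [hsum]
      simp only [iteratedDeriv_const, Nat.succ_ne_zero, if_false] at e
      linear_combination (-1 / Y (-w) p) * e
  refine ⟨s, h, hh, ?_⟩
  filter_upwards [hqQ, self_mem_nhdsWithin] with x e hxp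
  have hxn : x - p ≠ 0 := sub_ne_zero.mpr hxp
  rw [hQQ₁, hQh, hc] at e
  push_cast
  field_simp
  linear_combination e + hsQ

/-! ### From global hypotheses to punctured neighbourhoods -/

lemma eventually_codiscrete_iff {P : ℂ → Prop} :
    (∀ᶠ x in codiscrete ℂ, P x) ↔ ∀ p, ∀ᶠ x in 𝓝[≠] p, P x := by
  have := mem_codiscreteWithin_iff_forall_mem_nhdsNE (S := {x | P x}) (T := (Set.univ : Set ℂ))
  simpa using! this

lemma tendsto_add_right_nhdsNE (p l : ℂ) : Tendsto (· + l) (𝓝[≠] p) (𝓝[≠] (p + l)) := by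
  refine tendsto_nhdsWithin_iff.mpr ⟨?_, ?_⟩
  · exact ((continuous_add_const l).tendsto p).mono_left nhdsWithin_le_nhds
  · filter_upwards [self_mem_nhdsWithin] with x hx
    simpa using hx

/-- The periods form a subgroup, so it suffices to check the two generators. -/
lemma HasPeriods.eventually_add_lattice {L : PeriodPair} {f : ℂ → ℂ} (hf : HasPeriods L f) {l : ℂ}
    (hl : l ∈ L.lattice) (p : ℂ) : ∀ᶠ x in 𝓝[≠] p, f (x + l) = f x := by
  have hadd : ∀ a b : ℂ, (∀ p, ∀ᶠ x in 𝓝[≠] p, f (x + a) = f x) →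
      (∀ p, ∀ᶠ x in 𝓝[≠] p, f (x + b) = f x) → ∀ p, ∀ᶠ x in 𝓝[≠] p, f (x + (a + b)) = f x := by
    intro a b ha hb p
    filter_upwards [ha p, (tendsto_add_right_nhdsNE p a).eventually (hb (p + a))] with x h1 h2
    rw [← add_assoc, h2, h1]
  have hneg : ∀ a : ℂ, (∀ p, ∀ᶠ x in 𝓝[≠] p, f (x + a) = f x) →
      ∀ p, ∀ᶠ x in 𝓝[≠] p, f (x + -a) = f x := by
    intro a ha p
    filter_upwards [(tendsto_add_right_nhdsNE p (-a)).eventually (ha (p + -a))] with x h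
    rw [← h, neg_add_cancel_right]
  let G : AddSubgroup ℂ :=
    { carrier := {l | ∀ p, ∀ᶠ x in 𝓝[≠] p, f (x + l) = f x}
      add_mem' := fun ha hb ↦ hadd _ _ ha hb
      zero_mem' := fun p ↦ by simp
      neg_mem' := fun ha ↦ hneg _ ha }
  have hle : L.lattice ≤ AddSubgroup.toIntSubmodule G := by
    refine Submodule.span_le.mpr ?_
    rintro x (rfl | rfl)
    · exact eventually_codiscrete_iff.mp hf.1
    · exact eventually_codiscrete_iff.mp hf.2
  exact hle hl p

/-- Global independence implies local independence: a meromorphic function on `ℂ` vanishing near one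
point vanishes identically. -/
lemma IsPicardPotential.exists_principal_part {q : ℂ → ℂ} (hq : IsPicardPotential q) (p : ℂ) :
    ∃ (s : ℤ) (g : ℂ → ℂ), AnalyticAt ℂ g p ∧
      ∀ᶠ x in 𝓝[≠] p, q x = -(s * (s + 1)) / (x - p) ^ 2 + g x := by
  refine exists_eventuallyEq_principal_part fun z ↦ ?_
  obtain ⟨y₁, y₂, h₁, h₂, hind⟩ := hq.2 z
  refine ⟨y₁, y₂, ⟨h₁.1 p, eventually_codiscrete_iff.mp h₁.2 p⟩,
    ⟨h₂.1 p, eventually_codiscrete_iff.mp h₂.2 p⟩, fun c₁ c₂ hc ↦ hind c₁ c₂ ?_⟩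
  have hm : Meromorphic (fun x ↦ c₁ * y₁ x + c₂ * y₂ x) := by
    intro x
    have := h₁.1 x
    have := h₂.1 x
    fun_prop
  rw [eventually_codiscrete_iff]
  intro x
  rw [← meromorphicOrderAt_eq_top_iff]
  by_contra hx
  exact hm.exists_meromorphicOrderAt_ne_top_iff_forall.mp ⟨x, hx⟩ p
    (meromorphicOrderAt_eq_top_iff.mpr hc)

/-! ### Removable singularities and Liouville -/

/-- `f` has at worst a removable singularity at `x`. -/
def RegularAt (f : ℂ → ℂ) (x : ℂ) : Prop :=
  ∃ g : ℂ → ℂ, AnalyticAt ℂ g x ∧ f =ᶠ[𝓝[≠] x] g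

lemma RegularAt.of_add {f : ℂ → ℂ} {x l : ℂ} (h : RegularAt f (x + l))
    (hl : ∀ᶠ y in 𝓝[≠] x, f (y + l) = f y) : RegularAt f x := by
  obtain ⟨g, hg, hfg⟩ := h
  refine ⟨fun y ↦ g (y + l), hg.comp_of_eq (by fun_prop) rfl, ?_⟩
  filter_upwards [hl, (tendsto_add_right_nhdsNE x l).eventually hfg] with y h1 h2
  rw [← h1, h2]

lemma finite_not_regularAt_inter {f : ℂ → ℂ} (hf : Meromorphic f) {K : Set ℂ}
    (hK : IsCompact K) : (K ∩ {x | ¬ RegularAt f x}).Finite := by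
  refine hK.induction_on (p := fun t ↦ (t ∩ {x | ¬ RegularAt f x}).Finite) (by simp)
    (fun s t hst ht ↦ ht.subset (Set.inter_subset_inter_left _ hst))
    (fun s t hs ht ↦ by rw [Set.union_inter_distrib_right]; exact hs.union ht) fun x _ ↦ ?_
  have h := (hf x).eventually_analyticAt
  rw [eventually_nhdsWithin_iff] at h
  refine ⟨_, mem_nhdsWithin_of_mem_nhds h, (Set.finite_singleton x).subset ?_⟩
  rintro y ⟨h1, h2⟩
  by_contra hy
  exact h2 ⟨f, h1 hy, .rfl⟩

lemma eq_of_eventually_nhdsNE {f g : ℂ → ℂ} {x : ℂ} (hf : ContinuousAt f x) (hg : ContinuousAt g x)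
    (h : f =ᶠ[𝓝[≠] x] g) : f x = g x :=
  ((hf.eventuallyEq_nhds_iff_eventuallyEq_nhdsNE hg).mp h).eq_of_nhds

/-- Liouville's theorem for a doubly periodic function with removable singularities only. -/
lemma exists_eventually_eq_const (L : PeriodPair) {f : ℂ → ℂ} (hreg : ∀ x, RegularAt f x)
    (hper : ∀ l ∈ L.lattice, ∀ p, ∀ᶠ x in 𝓝[≠] p, f (x + l) = f x) :
    ∃ C : ℂ, ∀ p, ∀ᶠ x in 𝓝[≠] p, f x = C := by
  choose g hg hfg using hreg
  -- The local extensions agree by continuity, so their diagonal values form an entire function.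
  let F : ℂ → ℂ := fun x ↦ g x x
  have hFg : ∀ x, F =ᶠ[𝓝[≠] x] g x := fun x ↦ by
    filter_upwards [(hg x).eventually_analyticAt.filter_mono nhdsWithin_le_nhds,
      eventually_eventually_nhdsWithin.mpr (hfg x), self_mem_nhdsWithin] with y h2 h3 hyx
    rw [(isOpen_compl_singleton (x := x)).nhdsWithin_eq hyx] at h3
    exact eq_of_eventually_nhdsNE (f := g y) (hg y).continuousAt h2.continuousAt
      ((hfg y).symm.trans (h3.filter_mono nhdsWithin_le_nhds))
  have hFan : ∀ x, AnalyticAt ℂ F x := fun x ↦ by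
    refine (hg x).congr (EventuallyEq.symm ?_)
    exact eventuallyEq_nhds_of_eventuallyEq_nhdsNE (hFg x) rfl
  have hFf : ∀ x, F =ᶠ[𝓝[≠] x] f := fun x ↦ (hFg x).trans (hfg x).symm
  have hFper : ∀ z w, w ∈ L.lattice → F (z + w) = F z := fun z w hw ↦ by
    refine eq_of_eventually_nhdsNE (f := fun z ↦ F (z + w))
      ((hFan (z + w)).continuousAt.comp_of_eq (by fun_prop) rfl) (hFan z).continuousAt ?_
    filter_upwards [hper w hw z, hFf z, (tendsto_add_right_nhdsNE z w).eventually (hFf (z + w))]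
      with x h1 h2 h3
    rw [h3, h1, h2]
  have hFd : Differentiable ℂ F := fun x ↦ (hFan x).differentiableAt
  refine ⟨F 0, fun p ↦ ?_⟩
  filter_upwards [hFf p] with x hx
  rw [← hx]
  exact hFd.apply_eq_apply_of_bounded (IsZLattice.isCompact_range_of_periodic L.lattice _
    hFd.continuous hFper).isBounded x 0

/-! ### Subtraction of the principal parts -/

lemma exists_analyticAt_weierstrassP_sub (L : PeriodPair) (b : ℂ) :
    ∃ h : ℂ → ℂ, AnalyticAt ℂ h b ∧ ∀ x, L.weierstrassP (x - b) = 1 / (x - b) ^ 2 + h x := by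
  refine ⟨fun x ↦ L.weierstrassPExcept 0 (x - b),
    (L.analyticAt_weierstrassPExcept 0).comp_of_eq (by fun_prop) (sub_self b), fun x ↦ ?_⟩
  rw [← L.weierstrassPExcept_add 0 (x - b)]
  simp [add_comm]

lemma analyticAt_weierstrassP_sub (L : PeriodPair) {b x : ℂ} (h : x - b ∉ L.lattice) :
    AnalyticAt ℂ (fun y ↦ L.weierstrassP (y - b)) x :=
  (L.analyticOnNhd_weierstrassP _ h).comp_of_eq (f := fun y ↦ y - b) (by fun_prop) rfl

end PicardKdV

open PicardKdV Topology

theorem theorem3p5 (q : ℂ → ℂ) (hq : PicardKdV.IsPicardPotential q)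
    (L : PeriodPair) (hL : PicardKdV.HasPeriods L q) :
    ∃ (m : ℕ) (s : Fin m → ℤ) (C : ℂ) (b : Fin m → ℂ),
      (∀ j k : Fin m, j ≠ k → b j - b k ∉ L.lattice) ∧
      ∀ x : ℂ, AnalyticAt ℂ q x →
        q x = C - ∑ j : Fin m, (s j : ℂ) * ((s j : ℂ) + 1) * L.weierstrassP (x - b j) := by
  choose s g hg hqg using hq.exists_principal_part
  have hlat : ∀ x, x ∈ L.lattice ↔ x ∈ Submodule.span ℤ (Set.range L.basis) := fun x ↦ by
    rw [L.lattice_eq_span_range_basis]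
  have hfin : (ZSpan.fundamentalDomain L.basis ∩ {x | ¬ RegularAt q x}).Finite :=
    (finite_not_regularAt_inter hq.1.1
      (ZSpan.fundamentalDomain_isBounded L.basis).isCompact_closure).subset
      (Set.inter_subset_inter_left _ subset_closure)
  -- The `b j` enumerate the non-removable singularities in the fundamental domain, one per lattice
  -- class.
  let e := hfin.toFinset.equivFin
  let b : Fin hfin.toFinset.card → ℂ := fun j ↦ e.symm j
  have hb : ∀ j, b j ∈ ZSpan.fundamentalDomain L.basis ∧ ¬ RegularAt q (b j) := fun j ↦
    hfin.mem_toFinset.mp (e.symm j).2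
  have hbsurj : ∀ x ∈ ZSpan.fundamentalDomain L.basis, ¬ RegularAt q x → ∃ j, b j = x :=
    fun x h1 h2 ↦ ⟨e ⟨x, hfin.mem_toFinset.mpr ⟨h1, h2⟩⟩, by simp [b]⟩
  have hbinj : Function.Injective b := Subtype.val_injective.comp e.symm.injective
  have hdom : ∀ x ∈ ZSpan.fundamentalDomain L.basis, ∀ y ∈ ZSpan.fundamentalDomain L.basis,
      x - y ∈ L.lattice → x = y := fun x hx y hy h ↦ by
    rw [← ZSpan.fract_eq_self.mpr hx, ← ZSpan.fract_eq_self.mpr hy, ZSpan.fract_eq_fract, ← hlat]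
    simpa [neg_add_eq_sub] using neg_mem h
  let P : ℂ → ℂ := fun x ↦ ∑ j, (s (b j) : ℂ) * ((s (b j) : ℂ) + 1) * L.weierstrassP (x - b j)
  have hper : ∀ l ∈ L.lattice, ∀ p, ∀ᶠ x in 𝓝[≠] p, q (x + l) + P (x + l) = q x + P x := by
    intro l hl p
    filter_upwards [hL.eventually_add_lattice hl p] with x hx
    rw [hx]
    congr 1
    refine Finset.sum_congr rfl fun j _ ↦ ?_
    rw [add_sub_right_comm, L.weierstrassP_add_coe _ ⟨l, hl⟩]
  have hregdom : ∀ x ∈ ZSpan.fundamentalDomain L.basis, RegularAt (fun x ↦ q x + P x) x := by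
    intro x hx
    by_cases hqx : RegularAt q x
    · obtain ⟨h, hh, hqh⟩ := hqx
      have hP : AnalyticAt ℂ P x := Finset.univ.analyticAt_fun_sum fun j _ ↦ by
        have := analyticAt_weierstrassP_sub L (x := x) (b := b j) fun hmem ↦
          (hb j).2 (hdom x hx _ (hb j).1 hmem ▸ ⟨h, hh, hqh⟩)
        fun_prop
      refine ⟨fun x ↦ h x + P x, by fun_prop, ?_⟩
      filter_upwards [hqh] with y hy
      rw [hy]
    -- Only the `i`-th summand is singular here, and its double pole cancels that of `q`.
    · obtain ⟨i, rfl⟩ := hbsurj x hx hqx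
      obtain ⟨h, hh, hPh⟩ := exists_analyticAt_weierstrassP_sub L (b i)
      have hR : AnalyticAt ℂ (fun x ↦ ∑ j ∈ Finset.univ.erase i,
          (s (b j) : ℂ) * ((s (b j) : ℂ) + 1) * L.weierstrassP (x - b j)) (b i) :=
        Finset.analyticAt_fun_sum _ fun j hj ↦ by
          have := analyticAt_weierstrassP_sub L (x := b i) (b := b j) fun hmem ↦
            Finset.ne_of_mem_erase hj (hbinj (hdom _ (hb i).1 _ (hb j).1 hmem)).symm
          fun_prop
      have hgi := hg (b i)
      refine ⟨fun x ↦ g (b i) x + (s (b i) * (s (b i) + 1) * h x + ∑ j ∈ Finset.univ.erase i,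
          (s (b j) : ℂ) * ((s (b j) : ℂ) + 1) * L.weierstrassP (x - b j)), by fun_prop, ?_⟩
      filter_upwards [hqg (b i)] with y hy
      simp only [P]
      rw [hy, ← Finset.add_sum_erase _ _ (Finset.mem_univ i), hPh]
      ring
  have hreduce : ∀ (f : ℂ → ℂ), (∀ l ∈ L.lattice, ∀ p, ∀ᶠ x in 𝓝[≠] p, f (x + l) = f x) →
      ∀ x, RegularAt f (ZSpan.fract L.basis x) → RegularAt f x := by
    intro f hf x hx
    have hmem : -(ZSpan.floor L.basis x : ℂ) ∈ L.lattice :=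
      neg_mem ((hlat _).mpr (ZSpan.floor L.basis x).2)
    rw [ZSpan.fract_apply, sub_eq_add_neg] at hx
    exact hx.of_add (hf _ hmem x)
  obtain ⟨C, hC⟩ := exists_eventually_eq_const L (f := fun x ↦ q x + P x)
    (fun x ↦ hreduce _ hper x (hregdom _ (ZSpan.fract_mem_fundamentalDomain _ x))) hper
  refine ⟨_, fun j ↦ s (b j), C, b, fun j k hjk hmem ↦
    hjk (hbinj (hdom _ (hb j).1 _ (hb k).1 hmem)), fun x hx ↦ ?_⟩
  -- Were `x` congruent to some `b j`, periodicity would carry the regularity of `q` from `x` to `b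
  -- j`.
  have hP : AnalyticAt ℂ P x := Finset.univ.analyticAt_fun_sum fun j _ ↦ by
    have := analyticAt_weierstrassP_sub L (x := x) (b := b j) fun hmem ↦ (hb j).2 <| by
      refine RegularAt.of_add (l := x - b j) ?_ (hL.eventually_add_lattice hmem _)
      rw [add_sub_cancel]
      exact ⟨q, hx, .rfl⟩
    fun_prop
  have := eq_of_eventually_nhdsNE (f := fun x ↦ q x + P x) (hx.add hP).continuousAt
    (continuousAt_const (y := C)) (hC x)
  exact eq_sub_of_add_eq this
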